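/- All sets are subsets of $\omega$; $\subseteq^*$ and $=^*$ denote inclusion and equality up to finitely many elements. For a c.e. set $A$ let $\mathcal L(A)=\{W\cup A: W\text{ c.e.}\}$, ordered by inclusion, let $\mathcal D(A)=\{B\in\mathcal L(A): B-A\text{ is c.e.}\}$, and let $\mathcal L^*(A)$, $\mathcal D^*(A)$ be their quotients modulo finite sets. The c.e. set $A$ is *$\mathcal D$-maximal* if $\mathcal L^*(A)/\mathcal D^*(A)$ is the two-element Boolean algebra. It is *strongly $r$-separable* if for every c.e. set $B$ disjoint from $A$ there is a computable set $C$ with $B\subseteq C$, $A\subseteq\overline C$ and $C-B$ infinite. It is *Herrmann* if it is $\mathcal D$-maximal and strongly $r$-separable. A noncomputable c.e. set $A$ is *hemi-Herrmann* if there is a noncomputable c.e. set $B$ disjoint from $A$ such that $A\sqcup B$ is Herrmann. A collection $\mathcal G$ of c.e. sets *generates* $\mathcal D(A)$ if every member of $\mathcal G$ is disjoint from $A$ and every c.e. set $D$ disjoint from $A$ satisfies $D\subseteq^*\bigcup\mathcal F$ for some finite $\mathcal F\subseteq\mathcal G$. A generating set is of - Type 1 if it is $\{\emptyset\}$; - Type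 2 if it is $\{R\}$ with $R$ infinite and computable; - Type 3 if it is $\{W\}$ with $W$ an infinite noncomputable c.e. set; - Type 4 if it is $\{R_0,R_1,\ldots\}$, where the $R_i$ $(i\in\omega)$ are infinite pairwise disjoint computable sets; - Type 5 if it is $\{D_0,R_0,R_1,\ldots\}$, where $D_0$ is a noncomputable c.e. set, the $R_i$ $(i\in\omega)$ are computable, and all these sets are infinite and pairwise disjoint. For $n\in\{4,5\}$, a c.e. set $A$ *is Type $n$* if $\mathcal D(A)$ has a generating set of Type $n$ but none of Type $m$ for any $m<n$. **Lemma.** For every set $A\subseteq\omega$: (i) $A$ is $\mathcal D$-maximal and Type 4 if and only if $A$ is Herrmann; (ii) $A$ is $\mathcal D$-maximal and Type 5 if and only if $A$ is hemi-Herrmann. -/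

import Mathlib

namespace DMax

/-- `S` is a computably enumerable (c.e.) set of natural numbers. -/
def IsCE (S : Set ℕ) : Prop := REPred (fun n => n ∈ S)

/-- `S` is a computable set of natural numbers. -/
def IsComputable (S : Set ℕ) : Prop := ComputablePred (fun n => n ∈ S)

/-- `X ⊆* Y`: all but finitely many elements of `X` belong to `Y`. -/
def AlmostSubset (X Y : Set ℕ) : Prop := (X \ Y).Finite

/-- `X =* Y`: `X` and `Y` differ by finitely many elements. -/
def AlmostEq (X Y : Set ℕ) : Prop := AlmostSubset X Y ∧ AlmostSubset Y X

/-- The lattice `𝓛(A)` of all sets `W ∪ A` with `W` c.e., ordered by inclusion. -/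
def supersetLattice (A : Set ℕ) : Set (Set ℕ) := {X | ∃ W, IsCE W ∧ X = W ∪ A}

/-- The ideal `𝓓(A)` of all `B ∈ 𝓛(A)` such that `B - A` is c.e. -/
def idealD (A : Set ℕ) : Set (Set ℕ) := {B | B ∈ supersetLattice A ∧ IsCE (B \ A)}

/-- `X` and `Y` represent the same element of the quotient lattice `𝓛*(A) / 𝓓*(A)`: modulo finite
sets they have the same join with some member of the ideal. -/
def EquivModD (A X Y : Set ℕ) : Prop := ∃ I ∈ idealD A, AlmostEq (X ∪ I) (Y ∪ I)

/-- The c.e. set `A` is `𝓓`-maximal: the quotient `𝓛*(A) / 𝓓*(A)` is the two-element Boolean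
algebra, i.e. its bottom (the class of `A`) and its top (the class of `ℕ`) are different, and it
has no further element. -/
def IsDMaximal (A : Set ℕ) : Prop :=
  IsCE A ∧ ¬ EquivModD A A Set.univ ∧
    ∀ X ∈ supersetLattice A, EquivModD A X A ∨ EquivModD A X Set.univ

/-- The c.e. set `A` is strongly `r`-separable: every c.e. set `B` disjoint from `A` is contained in
a computable set `C` disjoint from `A` such that `C - B` is infinite. -/
def IsStronglyRSeparable (A : Set ℕ) : Prop :=
  IsCE A ∧ ∀ B, IsCE B → Disjoint B A →
    ∃ C, IsComputable C ∧ B ⊆ C ∧ A ⊆ Cᶜ ∧ (C \ B).Infinite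

/-- `A` is a Herrmann set. -/
def IsHerrmann (A : Set ℕ) : Prop := IsDMaximal A ∧ IsStronglyRSeparable A

/-- `A` is hemi-`P`: it is noncomputable and c.e., and for some noncomputable c.e. set `B` disjoint
from `A` the set `A ∪ B` satisfies `P`. -/
def Hemi (P : Set ℕ → Prop) (A : Set ℕ) : Prop :=
  IsCE A ∧ ¬ IsComputable A ∧
    ∃ B, IsCE B ∧ ¬ IsComputable B ∧ Disjoint A B ∧ P (A ∪ B)

/-- `A` is a hemi-Herrmann set. -/
def IsHemiHerrmann (A : Set ℕ) : Prop := Hemi IsHerrmann A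

/-- The collection `G` of c.e. sets generates `𝓓(A)`: its members are disjoint from `A`, and every
c.e. set disjoint from `A` is almost contained in the union of finitely many of them. -/
def Generates (G : Set (Set ℕ)) (A : Set ℕ) : Prop :=
  (∀ D ∈ G, IsCE D ∧ Disjoint D A) ∧
    ∀ D, IsCE D → Disjoint D A → ∃ F ⊆ G, F.Finite ∧ AlmostSubset D (⋃₀ F)

/-- `G` has the form `{∅}`. -/
def GenType1 (G : Set (Set ℕ)) : Prop := G = {∅}

/-- `G = {R}` with `R` infinite and computable. -/
def GenType2 (G : Set (Set ℕ)) : Prop := ∃ R, R.Infinite ∧ IsComputable R ∧ G = {R}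

/-- `G = {W}` with `W` infinite, c.e. and noncomputable. -/
def GenType3 (G : Set (Set ℕ)) : Prop :=
  ∃ W, W.Infinite ∧ IsCE W ∧ ¬ IsComputable W ∧ G = {W}

/-- `G = {R₀, R₁, …}` with the `Rᵢ` infinite, pairwise disjoint and computable. -/
def GenType4 (G : Set (Set ℕ)) : Prop :=
  ∃ R : ℕ → Set ℕ, (∀ i, (R i).Infinite ∧ IsComputable (R i)) ∧
    (∀ i j, i ≠ j → Disjoint (R i) (R j)) ∧ G = Set.range R

/-- `G = {D₀, R₀, R₁, …}` with all members infinite and pairwise disjoint, `D₀` c.e. and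
noncomputable, and the `Rᵢ` computable. -/
def GenType5 (G : Set (Set ℕ)) : Prop :=
  ∃ (D₀ : Set ℕ) (R : ℕ → Set ℕ), D₀.Infinite ∧ IsCE D₀ ∧ ¬ IsComputable D₀ ∧
    (∀ i, (R i).Infinite ∧ IsComputable (R i) ∧ Disjoint D₀ (R i)) ∧
    (∀ i j, i ≠ j → Disjoint (R i) (R j)) ∧ G = insert D₀ (Set.range R)

/-- Some collection of the form `T` generates `𝓓(A)`. -/
def HasGen (T : Set (Set ℕ) → Prop) (A : Set ℕ) : Prop := ∃ G, T G ∧ Generates G A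

/-- The c.e. set `A` is Type 4: `𝓓(A)` has a generating set of Type 4, but none of a smaller
Type. -/
def IsType4 (A : Set ℕ) : Prop :=
  IsCE A ∧ HasGen GenType4 A ∧ ¬ HasGen GenType1 A ∧ ¬ HasGen GenType2 A ∧ ¬ HasGen GenType3 A

/-- The c.e. set `A` is Type 5: `𝓓(A)` has a generating set of Type 5, but none of a smaller
Type. -/
def IsType5 (A : Set ℕ) : Prop :=
  IsCE A ∧ HasGen GenType5 A ∧ ¬ HasGen GenType1 A ∧ ¬ HasGen GenType2 A ∧
    ¬ HasGen GenType3 A ∧ ¬ HasGen GenType4 A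

end DMax

/-! Concretely (`isDMaximal_iff`), `A` is 𝓓-maximal when it is c.e. and noncomputable and, for some
c.e. `D` disjoint from `A`, each c.e. `W` is either almost inside `A ∪ D` or almost covers the
complement of `A ∪ D`.

Part (i) does not depend on 𝓓-maximality: strong r-separability is equivalent to having a Type 4
generating set. Iterated separation produces an increasing chain of computable sets whose
differences are the generators; conversely, an unused generator provides the infinite room that
separation needs. An infinite disjoint generating family excludes single generators, hence all
smaller Types.

For (ii), `D₀` plays the role of `B`. Adding `D₀` to `A` leaves the `R i` as generators. Conversely,
the dichotomy for `A ∪ B` shows that `B` is the only generator to be added in passing from `𝓓(A ∪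
B)` to `𝓓(A)`, and noncomputability of `B` excludes Type 4. -/

namespace DMax

/-! ### Closure properties of c.e. and computable sets -/

section Computability

variable {X Y F : Set ℕ}

theorem IsComputable.isCE (h : IsComputable X) : IsCE X := ComputablePred.to_re h

theorem IsComputable.compl (h : IsComputable X) : IsComputable Xᶜ := ComputablePred.not h

/-- Post's theorem. -/
theorem isComputable_iff : IsComputable X ↔ IsCE X ∧ IsCE Xᶜ :=
  ComputablePred.computable_iff_re_compl_re'

theorem IsCE.union (hX : IsCE X) (hY : IsCE Y) : IsCE (X ∪ Y) := by
  obtain ⟨k, hk, H⟩ := Partrec.merge hX hY (fun _ _ _ _ _ => rfl)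
  refine (Partrec.dom_re hk).of_eq fun n => ?_
  simp [Part.dom_iff_mem, H]

theorem IsCE.inter (hX : IsCE X) (hY : IsCE Y) : IsCE (X ∩ Y) := by
  have h : Partrec fun n => (Part.assert (n ∈ X) fun _ => Part.some ()).bind
      fun _ => Part.assert (n ∈ Y) fun _ => Part.some () :=
    Partrec.bind hX (Partrec.comp hY Computable.fst).to₂
  refine (Partrec.dom_re h).of_eq fun n => ?_
  simp [Part.dom_iff_mem]

theorem IsComputable.union (hX : IsComputable X) (hY : IsComputable Y) :
    IsComputable (X ∪ Y) := by
  rw [isComputable_iff, Set.compl_union]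
  exact ⟨hX.isCE.union hY.isCE, hX.compl.isCE.inter hY.compl.isCE⟩

theorem IsComputable.diff (hX : IsComputable X) (hY : IsComputable Y) :
    IsComputable (X \ Y) := by
  have h := (hX.compl.union hY).compl
  rwa [Set.compl_union, compl_compl, ← Set.sdiff_eq] at h

theorem isComputable_of_finite (hF : F.Finite) : IsComputable F := by
  induction F, hF using Set.Finite.induction_on with
  | empty => exact PrimrecPred.computablePred (PrimrecPred.of_eq (p := fun _ => False)
      ⟨inferInstance, by simpa using Primrec.const false⟩ fun _ => Iff.rfl)
  | @insert a s _ _ ih =>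
    have h : IsComputable {a} :=
      PrimrecPred.computablePred (Primrec.eq.comp Primrec.id (Primrec.const a))
    rw [Set.insert_eq]
    exact h.union ih

theorem isComputable_empty : IsComputable ∅ := isComputable_of_finite Set.finite_empty

theorem infinite_of_not_isComputable (h : ¬ IsComputable X) : X.Infinite :=
  fun hX => h (isComputable_of_finite hX)

theorem isComputable_iUnion_lt {R : ℕ → Set ℕ} (hR : ∀ i, IsComputable (R i)) (n : ℕ) :
    IsComputable (⋃ i < n, R i) := by
  induction n with
  | zero => simpa using isComputable_empty
  | succ n ih =>
    rw [Set.biUnion_lt_succ]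
    exact ih.union (hR n)

/-- A c.e. set is the domain of a partial recursive function, and there are only countably many of
these. -/
theorem countable_isCE : {X : Set ℕ | IsCE X}.Countable := by
  let f : {X : Set ℕ | IsCE X} → {f : ℕ →. ℕ // Partrec f} := fun X =>
    ⟨fun n => (Part.assert (n ∈ X.1) fun _ => Part.some ()).map fun _ => 0,
      Partrec.map X.2 (Computable.const 0).to₂⟩
  refine Function.Injective.countable (f := f) fun X Y h => Subtype.ext (Set.ext fun n => ?_)
  have h' := congrArg Part.Dom (congrFun (congrArg Subtype.val h) n)
  simpa [f, Part.dom_iff_mem] using h'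

end Computability

/-! ### Inclusion modulo finite sets -/

section AlmostSubset

variable {X Y Z : Set ℕ}

theorem AlmostSubset.of_subset (h : X ⊆ Y) : AlmostSubset X Y := by
  simp [AlmostSubset, Set.sdiff_eq_empty.2 h]

theorem AlmostSubset.trans (h₁ : AlmostSubset X Y) (h₂ : AlmostSubset Y Z) :
    AlmostSubset X Z :=
  (h₁.union h₂).subset fun x hx => by by_cases hy : x ∈ Y <;> simp_all

theorem AlmostSubset.mono_right (h : AlmostSubset X Y) (hYZ : Y ⊆ Z) : AlmostSubset X Z :=
  h.trans (.of_subset hYZ)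

theorem AlmostSubset.mono_left (hXY : X ⊆ Y) (h : AlmostSubset Y Z) : AlmostSubset X Z :=
  (of_subset hXY).trans h

theorem AlmostSubset.union (h₁ : AlmostSubset X Z) (h₂ : AlmostSubset Y Z) :
    AlmostSubset (X ∪ Y) Z := by
  rw [AlmostSubset, Set.union_sdiff_distrib]
  exact Set.Finite.union h₁ h₂

theorem AlmostSubset.union_union {X' Y' : Set ℕ} (h₁ : AlmostSubset X Y)
    (h₂ : AlmostSubset X' Y') : AlmostSubset (X ∪ X') (Y ∪ Y') :=
  (h₁.mono_right Set.subset_union_left).union (h₂.mono_right Set.subset_union_right)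

theorem AlmostSubset.of_union_of_disjoint (h : AlmostSubset X (Y ∪ Z)) (hd : Disjoint X Y) :
    AlmostSubset X Z :=
  h.subset fun _ hx => ⟨hx.1, fun h => h.elim (Set.disjoint_left.1 hd hx.1) hx.2⟩

theorem AlmostSubset.finite_of_disjoint (h : AlmostSubset X Y) (hd : Disjoint X Y) :
    X.Finite := by
  rwa [AlmostSubset, hd.sdiff_eq_left] at h

theorem AlmostEq.isComputable (h : AlmostEq X Y) (hX : IsComputable X) : IsComputable Y := by
  have h' := (hX.diff (isComputable_of_finite h.1)).union (isComputable_of_finite h.2)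
  convert h' using 1
  ext x
  simp only [Set.mem_union, Set.mem_sdiff]
  tauto

/-- A c.e. set with a c.e. almost complement is computable. -/
theorem isComputable_of_univ_almostSubset (hX : IsCE X) (hY : IsCE Y) (hd : Disjoint Y X)
    (h : AlmostSubset Set.univ (X ∪ Y)) : IsComputable X := by
  refine isComputable_iff.2 ⟨hX, ?_⟩
  have h' := hY.union (isComputable_of_finite h).isCE
  convert h' using 1
  ext x
  have : x ∈ Y → x ∉ X := fun hx => Set.disjoint_left.1 hd hx
  simp only [Set.mem_union, Set.mem_sdiff, Set.mem_compl_iff, Set.mem_univ, true_and]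
  tauto

end AlmostSubset

/-! ### 𝓓-maximality without quotients -/

section Ideal

variable {A : Set ℕ}

theorem union_mem_idealD {D : Set ℕ} (hD : IsCE D) (hd : Disjoint D A) : D ∪ A ∈ idealD A := by
  refine ⟨⟨D, hD, rfl⟩, ?_⟩
  rwa [Set.union_sdiff_right, hd.sdiff_eq_left]

theorem idealD_eq {I : Set ℕ} (hI : I ∈ idealD A) :
    ∃ D, IsCE D ∧ Disjoint D A ∧ I = D ∪ A := by
  refine ⟨I \ A, hI.2, Set.disjoint_sdiff_left, ?_⟩
  obtain ⟨⟨W, -, rfl⟩, -⟩ := hI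
  simp

theorem equivModD_iff {X Y : Set ℕ} (hX : A ⊆ X) (hY : A ⊆ Y) :
    EquivModD A X Y ↔ ∃ D, IsCE D ∧ Disjoint D A ∧ AlmostEq (X ∪ D) (Y ∪ D) := by
  have key : ∀ {Z D : Set ℕ}, A ⊆ Z → Z ∪ (D ∪ A) = Z ∪ D := fun {Z D} h => by
    rw [Set.union_comm D, ← Set.union_assoc, Set.union_eq_left.2 h]
  constructor
  · rintro ⟨I, hI, h⟩
    obtain ⟨D, hD, hd, rfl⟩ := idealD_eq hI
    rw [key hX, key hY] at h
    exact ⟨D, hD, hd, h⟩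
  · rintro ⟨D, hD, hd, h⟩
    refine ⟨D ∪ A, union_mem_idealD hD hd, ?_⟩
    rwa [key hX, key hY]

/-- Bottom and top coincide exactly when some c.e. `D` is almost the complement of `A`, that is,
when `A` is computable. -/
theorem isDMaximal_iff : IsDMaximal A ↔ IsCE A ∧ ¬ IsComputable A ∧ ∀ W, IsCE W →
    ∃ D, IsCE D ∧ Disjoint D A ∧
      (AlmostSubset W (A ∪ D) ∨ AlmostSubset Set.univ (W ∪ A ∪ D)) := by
  refine and_congr_right fun hA => and_congr (not_congr ?_) ?_
  · rw [equivModD_iff subset_rfl (Set.subset_univ _)]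
    constructor
    · rintro ⟨D, hD, hd, h⟩
      exact isComputable_of_univ_almostSubset hA hD hd (by simpa using h.2)
    · intro h
      exact ⟨Aᶜ, h.compl.isCE, disjoint_compl_left, .of_subset (by simp), .of_subset (by simp)⟩
  · constructor
    · intro h W hW
      rcases h (W ∪ A) ⟨W, hW, rfl⟩ with h | h
      · obtain ⟨D, hD, hd, h⟩ := (equivModD_iff Set.subset_union_right subset_rfl).1 h
        rw [Set.union_assoc] at h
        exact ⟨D, hD, hd, .inl (h.1.mono_left Set.subset_union_left)⟩
      · obtain ⟨D, hD, hd, h⟩ :=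
          (equivModD_iff Set.subset_union_right (Set.subset_univ _)).1 h
        exact ⟨D, hD, hd, .inr (by simpa using h.2)⟩
    · rintro h _ ⟨W, hW, rfl⟩
      rw [equivModD_iff Set.subset_union_right subset_rfl,
        equivModD_iff Set.subset_union_right (Set.subset_univ _)]
      obtain ⟨D, hD, hd, h | h⟩ := h W hW
      · refine .inl ⟨D, hD, hd, ?_, ?_⟩
        · rw [Set.union_assoc]
          exact h.union (.of_subset subset_rfl)
        · exact .of_subset (Set.union_subset_union_left _ Set.subset_union_right)
      · exact .inr ⟨D, hD, hd, .of_subset (by simp), by simpa using h⟩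

end Ideal

/-! ### Generating sets and strong r-separability -/

section GeneratingSets

variable {A : Set ℕ}

theorem exists_sUnion_subset_union_iUnion_lt {D₀ : Set ℕ} {R : ℕ → Set ℕ} {F : Set (Set ℕ)}
    (hF : F.Finite) (hFR : F ⊆ insert D₀ (Set.range R)) : ∃ n, ⋃₀ F ⊆ D₀ ∪ ⋃ i < n, R i := by
  induction F, hF using Set.Finite.induction_on with
  | empty => exact ⟨0, by simp⟩
  | @insert S F _ _ ih =>
    obtain ⟨n, hn⟩ := ih ((Set.subset_insert _ _).trans hFR)
    rw [Set.sUnion_insert]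
    rcases hFR (Set.mem_insert _ _) with rfl | ⟨j, rfl⟩
    · exact ⟨n, Set.union_subset Set.subset_union_left hn⟩
    · refine ⟨max n (j + 1), Set.union_subset ?_ (hn.trans ?_)⟩
      · exact (Set.subset_biUnion_of_mem (u := R) (show j ∈ {i | i < max n (j + 1)} by simp)).trans
          Set.subset_union_right
      · refine Set.union_subset_union_right _
          (Set.biUnion_mono (fun i hi => ?_) fun _ _ => subset_rfl)
        exact lt_max_of_lt_left (show i < n from hi)

theorem generates_insert_range_iff {D₀ : Set ℕ} {R : ℕ → Set ℕ} :
    Generates (insert D₀ (Set.range R)) A ↔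
      (IsCE D₀ ∧ Disjoint D₀ A) ∧ (∀ i, IsCE (R i) ∧ Disjoint (R i) A) ∧
      ∀ D, IsCE D → Disjoint D A → ∃ n, AlmostSubset D (D₀ ∪ ⋃ i < n, R i) := by
  simp only [Generates, Set.forall_mem_insert, Set.forall_mem_range, and_assoc]
  refine and_congr_right fun _ => and_congr_right fun _ => and_congr_right fun _ =>
    forall_congr' fun D => forall_congr' fun _ => forall_congr' fun _ => ?_
  constructor
  · rintro ⟨F, hFR, hF, h⟩
    obtain ⟨n, hn⟩ := exists_sUnion_subset_union_iUnion_lt hF hFR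
    exact ⟨n, h.mono_right hn⟩
  · rintro ⟨n, h⟩
    refine ⟨insert D₀ (R '' {i | i < n}), Set.insert_subset_insert (Set.image_subset_range _ _),
      ((Set.finite_lt_nat n).image R).insert D₀, ?_⟩
    rwa [Set.sUnion_insert, Set.sUnion_image]

/-- Lets Type 4 families be handled as the case `D₀ = ∅` of the Type 5 form. -/
theorem generates_insert_empty_iff {G : Set (Set ℕ)} :
    Generates (insert ∅ G) A ↔ Generates G A := by
  simp only [Generates, Set.forall_mem_insert, Set.empty_disjoint, and_true,
    isComputable_empty.isCE, true_and]
  refine and_congr_right fun _ =>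
    forall_congr' fun D => forall_congr' fun _ => forall_congr' fun _ => ?_
  constructor
  · rintro ⟨F, hFG, hF, h⟩
    exact ⟨F \ {∅}, by simpa [Set.sdiff_subset_iff] using hFG, hF.sdiff, by simpa using h⟩
  · rintro ⟨F, hFG, hF, h⟩
    exact ⟨F, hFG.trans (Set.subset_insert _ _), hF, h⟩

theorem generates_range_iff {R : ℕ → Set ℕ} :
    Generates (Set.range R) A ↔ (∀ i, IsCE (R i) ∧ Disjoint (R i) A) ∧
      ∀ D, IsCE D → Disjoint D A → ∃ n, AlmostSubset D (⋃ i < n, R i) := by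
  rw [← generates_insert_empty_iff, generates_insert_range_iff]
  simp [isComputable_empty.isCE]

theorem disjoint_iUnion_lt {X : Set ℕ} {R : ℕ → Set ℕ} {n : ℕ}
    (h : ∀ i < n, Disjoint X (R i)) : Disjoint X (⋃ i < n, R i) := by
  simpa only [Set.disjoint_iUnion_right] using h

/-- No single set generates `𝓓(A)` if a generating set has infinitely many infinite, pairwise
disjoint members. -/
theorem not_generates_singleton {D₀ : Set ℕ} {R : ℕ → Set ℕ}
    (hinf : ∀ i, (R i).Infinite) (hD₀ : ∀ i, Disjoint D₀ (R i))
    (hR : ∀ i j, i ≠ j → Disjoint (R i) (R j))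
    (hG : Generates (insert D₀ (Set.range R)) A) (W : Set ℕ) : ¬ Generates {W} A := by
  rintro ⟨hW, hgen⟩
  obtain ⟨-, hRA, hgen'⟩ := generates_insert_range_iff.1 hG
  obtain ⟨n, hn⟩ := hgen' W (hW W rfl).1 (hW W rfl).2
  obtain ⟨F, hF, -, h⟩ := hgen (R n) (hRA n).1 (hRA n).2
  have hFW : ⋃₀ F ⊆ W := Set.sUnion_subset fun S hS => (hF hS).le
  -- `R n` would be almost contained in `W`, hence in a union of generators disjoint from it.
  refine hinf n (((h.mono_right hFW).trans hn).finite_of_disjoint ?_)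
  exact (hD₀ n).symm.union_right (disjoint_iUnion_lt fun i hi => hR _ _ hi.ne')

theorem not_hasGen_of_not_generates_singleton (h : ∀ W, ¬ Generates {W} A) :
    ¬ HasGen GenType1 A ∧ ¬ HasGen GenType2 A ∧ ¬ HasGen GenType3 A := by
  refine ⟨?_, ?_, ?_⟩
  · rintro ⟨G, rfl, hG⟩
    exact h _ hG
  · rintro ⟨G, ⟨R, -, -, rfl⟩, hG⟩
    exact h _ hG
  · rintro ⟨G, ⟨W, -, -, -, rfl⟩, hG⟩
    exact h _ hG

theorem isType4_iff : IsType4 A ↔ IsCE A ∧ HasGen GenType4 A := by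
  refine and_congr_right fun _ => ⟨And.left, fun h => ⟨h, ?_⟩⟩
  obtain ⟨G, ⟨R, hR, hdisj, rfl⟩, hG⟩ := h
  exact not_hasGen_of_not_generates_singleton (not_generates_singleton (fun i => (hR i).1)
    (fun _ => Set.empty_disjoint _) hdisj (generates_insert_empty_iff.2 hG))

theorem IsStronglyRSeparable.of_hasGen (hA : IsCE A) (h : HasGen GenType4 A) :
    IsStronglyRSeparable A := by
  obtain ⟨G, ⟨R, hR, hdisj, rfl⟩, hG⟩ := h
  obtain ⟨hRA, hgen⟩ := generates_range_iff.1 hG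
  refine ⟨hA, fun B hB hBA => ?_⟩
  obtain ⟨n, hn⟩ := hgen B hB hBA
  -- The generators below `n` almost cover `B`, the finite remainder is added by hand, and `R n`
  -- makes `C \ B` infinite.
  refine ⟨(⋃ i < n + 1, R i) ∪ (B \ ⋃ i < n, R i),
    (isComputable_iUnion_lt (fun i => (hR i).2) _).union (isComputable_of_finite hn), ?_, ?_, ?_⟩
  · rw [Set.biUnion_lt_succ, Set.union_right_comm]
    exact Set.subset_union_of_subset_left (by simp) _
  · refine Set.subset_compl_iff_disjoint_left.2 (Disjoint.union_left ?_ ?_)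
    · exact (disjoint_iUnion_lt fun i _ => (hRA i).2.symm).symm
    · exact hBA.mono_left Set.sdiff_subset
  · refine ((hR n).1.sdiff hn).mono ?_
    intro x hx
    refine ⟨.inl (Set.mem_biUnion (Nat.lt_succ_self n) hx.1), fun hxB => hx.2 ⟨hxB, ?_⟩⟩
    exact Set.disjoint_left.1 (disjoint_iUnion_lt fun i hi => hdisj n i hi.ne') hx.1

theorem IsStronglyRSeparable.hasGen (h : IsStronglyRSeparable A) : HasGen GenType4 A := by
  obtain ⟨hA, h⟩ := h
  choose! c hc using h
  have hcount : {B | IsCE B ∧ Disjoint B A}.Countable :=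
    countable_isCE.mono fun _ h => h.1
  obtain ⟨B, hB⟩ := hcount.exists_eq_range ⟨∅, isComputable_empty.isCE, Set.empty_disjoint _⟩
  have hBA : ∀ n, IsCE (B n) ∧ Disjoint (B n) A := fun n =>
    (hB.symm ▸ Set.mem_range_self n : B n ∈ {B | IsCE B ∧ Disjoint B A})
  -- Each stage separates the previous stage together with the next c.e. set `B n` from `A`, with
  -- infinitely many new elements.
  let C : ℕ → Set ℕ := fun n => Nat.rec ∅ (fun n S => c (S ∪ B n)) n
  have hC : ∀ n, IsComputable (C n) ∧ Disjoint (C n) A := by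
    intro n
    induction n with
    | zero => exact ⟨isComputable_empty, Set.empty_disjoint _⟩
    | succ n ih =>
      have := hc (C n ∪ B n) (ih.1.isCE.union (hBA n).1) (ih.2.union_left (hBA n).2)
      exact ⟨this.1, Set.subset_compl_iff_disjoint_left.1 this.2.2.1⟩
  have hstep : ∀ n, C n ∪ B n ⊆ C (n + 1) ∧ (C (n + 1) \ (C n ∪ B n)).Infinite := fun n =>
    (hc (C n ∪ B n) ((hC n).1.isCE.union (hBA n).1) ((hC n).2.union_left (hBA n).2)).2.imp_right
      And.right
  have hmono : Monotone C :=
    monotone_nat_of_le_succ fun n => Set.subset_union_left.trans (hstep n).1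
  have hsub : ∀ n, C n ⊆ ⋃ i < n, C (i + 1) \ C i := by
    intro n
    induction n with
    | zero => exact Set.empty_subset _
    | succ n ih =>
      rw [Set.biUnion_lt_succ]
      intro x hx
      exact (Classical.em (x ∈ C n)).imp (fun h => ih h) fun h => ⟨hx, h⟩
  have hlt : ∀ i j, i < j → Disjoint (C (i + 1) \ C i) (C (j + 1) \ C j) := fun i j hij =>
    Set.disjoint_sdiff_right.mono_left (Set.sdiff_subset.trans (hmono hij))
  refine ⟨_, ⟨fun n => C (n + 1) \ C n, fun i => ⟨?_, (hC (i + 1)).1.diff (hC i).1⟩,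
      fun i j hij => ?_, rfl⟩,
    generates_range_iff.2 ⟨fun i => ⟨((hC (i + 1)).1.diff (hC i).1).isCE,
      (hC (i + 1)).2.mono_left Set.sdiff_subset⟩, fun D hD hDA => ?_⟩⟩
  · exact (hstep i).2.mono (Set.sdiff_subset_sdiff_right Set.subset_union_left)
  · exact hij.lt_or_gt.elim (hlt i j) fun h => (hlt j i h).symm
  · obtain ⟨n, rfl⟩ : D ∈ Set.range B := hB ▸ ⟨hD, hDA⟩
    exact ⟨n + 1, .of_subset ((Set.subset_union_right.trans (hstep n).1).trans (hsub (n + 1)))⟩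

theorem isHerrmann_iff : IsHerrmann A ↔ IsDMaximal A ∧ IsType4 A := by
  rw [isType4_iff]
  exact and_congr_right fun _ => ⟨fun h => ⟨h.1, h.hasGen⟩, fun h => .of_hasGen h.1 h.2⟩

end GeneratingSets

/-! ### Type 5 and hemi-Herrmann sets -/

section HemiHerrmann

variable {A : Set ℕ}

theorem IsHemiHerrmann.of_isType5 (hmax : IsDMaximal A) (h : IsType5 A) : IsHemiHerrmann A := by
  obtain ⟨hA, hAc, hdich⟩ := isDMaximal_iff.1 hmax
  obtain ⟨-, ⟨G, ⟨D₀, R, -, hD₀, hD₀c, hR, hdisj, rfl⟩, hG⟩, -⟩ := h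
  obtain ⟨⟨-, hD₀A⟩, hRA, hgen⟩ := generates_insert_range_iff.1 hG
  have hRH : ∀ i, Disjoint (R i) (A ∪ D₀) := fun i => (hRA i).2.union_right (hR i).2.2.symm
  refine ⟨hA, hAc, D₀, hD₀, hD₀c, hD₀A.symm, isDMaximal_iff.2 ⟨hA.union hD₀, ?_, ?_⟩,
    .of_hasGen (hA.union hD₀) ⟨_, ⟨R, fun i => ⟨(hR i).1, (hR i).2.1⟩, hdisj, rfl⟩,
      generates_range_iff.2 ⟨fun i => ⟨(hRA i).1, hRH i⟩, ?_⟩⟩⟩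
  -- Otherwise `D₀` and the complement of `A ∪ D₀` would make up a c.e. complement of `A`.
  · intro hc
    refine hAc (isComputable_of_univ_almostSubset hA (hD₀.union hc.compl.isCE)
      (hD₀A.union_left ?_) (.of_subset fun x _ => ?_))
    · exact disjoint_compl_left.mono_right Set.subset_union_left
    · rw [← Set.union_assoc, Set.union_compl_self]
      trivial
  · intro W hW
    obtain ⟨D, hD, hDA, h⟩ := hdich W hW
    obtain ⟨n, hn⟩ := hgen D hD hDA
    -- `D` may meet `D₀`; that part is absorbed by `A ∪ D₀`, so finitely many `R i` suffice.
    refine ⟨⋃ i < n, R i, (isComputable_iUnion_lt (fun i => (hR i).2.1) n).isCE,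
      (disjoint_iUnion_lt fun i _ => (hRH i).symm).symm, h.imp (fun h => ?_) fun h => ?_⟩
    · rw [Set.union_assoc]
      exact h.trans (AlmostSubset.union_union (.of_subset subset_rfl) hn)
    · rw [← Set.union_assoc, Set.union_assoc]
      exact h.trans (AlmostSubset.union_union (.of_subset subset_rfl) hn)
  · intro D hD hDH
    obtain ⟨n, hn⟩ := hgen D hD (hDH.mono_right Set.subset_union_left)
    exact ⟨n, hn.of_union_of_disjoint (hDH.mono_right Set.subset_union_right)⟩

theorem IsHemiHerrmann.isDMaximal (h : IsHemiHerrmann A) : IsDMaximal A := by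
  obtain ⟨hA, hAc, B, hB, -, hAB, hmax, -⟩ := h
  refine isDMaximal_iff.2 ⟨hA, hAc, fun W hW => ?_⟩
  obtain ⟨D, hD, hDH, h⟩ := (isDMaximal_iff.1 hmax).2.2 W hW
  refine ⟨B ∪ D, hB.union hD, hAB.symm.union_left (hDH.mono_right Set.subset_union_left), ?_⟩
  simpa only [Set.union_assoc] using h

/-- If `A ∪ B` is `𝓓`-maximal, then `B` together with generators of `𝓓(A ∪ B)` generates `𝓓(A)`. -/
theorem Generates.insert_of_union {B : Set ℕ} {R : ℕ → Set ℕ} (hA : IsCE A)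
    (hAc : ¬ IsComputable A) (hB : IsCE B) (hAB : Disjoint A B) (hmax : IsDMaximal (A ∪ B))
    (hG : Generates (Set.range R) (A ∪ B)) : Generates (insert B (Set.range R)) A := by
  obtain ⟨hRH, hgen⟩ := generates_range_iff.1 hG
  refine generates_insert_range_iff.2 ⟨⟨hB, hAB.symm⟩,
    fun i => ⟨(hRH i).1, (hRH i).2.mono_right Set.subset_union_left⟩, fun D hD hDA => ?_⟩
  obtain ⟨E, hE, hEH, h | h⟩ := (isDMaximal_iff.1 hmax).2.2 D hD
  · obtain ⟨n, hn⟩ := hgen E hE hEH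
    rw [Set.union_assoc] at h
    exact ⟨n, (h.of_union_of_disjoint hDA).trans (.union_union (.of_subset subset_rfl) hn)⟩
  -- Here `D ∪ B ∪ E` is c.e., disjoint from `A` and almost all of its complement, so `A` would be
  -- computable.
  · refine absurd (isComputable_of_univ_almostSubset hA ((hD.union hB).union hE)
      ((hDA.union_left hAB.symm).union_left (hEH.mono_right Set.subset_union_left))
      (h.mono_right ?_)) hAc
    intro x
    simp only [Set.mem_union]
    tauto

theorem IsHemiHerrmann.isType5 (h : IsHemiHerrmann A) : IsType5 A := by
  obtain ⟨hA, hAc, B, hB, hBc, hAB, hmax, hsep⟩ := h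
  obtain ⟨G, ⟨R, hR, hdisj, rfl⟩, hG⟩ := hsep.hasGen
  have hBR : ∀ i, Disjoint B (R i) := fun i =>
    (((generates_range_iff.1 hG).1 i).2.mono_right Set.subset_union_right).symm
  have hG' := hG.insert_of_union hA hAc hB hAB hmax
  obtain ⟨h₁, h₂, h₃⟩ := not_hasGen_of_not_generates_singleton
    (not_generates_singleton (fun i => (hR i).1) hBR hdisj hG')
  refine ⟨hA, ⟨_, ⟨B, R, infinite_of_not_isComputable hBc, hB, hBc,
    fun i => ⟨(hR i).1, (hR i).2, hBR i⟩, hdisj, rfl⟩, hG'⟩, h₁, h₂, h₃, ?_⟩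
  rintro ⟨_, ⟨S, hS, -, rfl⟩, hGS⟩
  obtain ⟨hSA, hgenS⟩ := generates_range_iff.1 hGS
  obtain ⟨m, hm⟩ := hgenS B hB hAB.symm
  have hSm := isComputable_iUnion_lt (fun i => (hS i).2) m
  obtain ⟨n, hn⟩ := (generates_insert_range_iff.1 hG').2.2 _ hSm.isCE
    (disjoint_iUnion_lt fun i _ => (hSA i).2.symm).symm
  have hBRn : Disjoint B (⋃ i < n, R i) := disjoint_iUnion_lt fun i _ => hBR i
  -- Removing the `R i` with `i < n` from the union of the `S i` with `i < m` leaves `B` up to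
  -- finitely many elements.
  refine hBc (AlmostEq.isComputable ⟨?_, ?_⟩
    (hSm.diff (isComputable_iUnion_lt (fun i => (hR i).2) n)))
  · exact hn.subset fun x hx => ⟨hx.1.1, fun h => h.elim hx.2 hx.1.2⟩
  · exact hm.subset fun x hx =>
      ⟨hx.1, fun hxS => hx.2 ⟨hxS, Set.disjoint_left.1 hBRn hx.1⟩⟩

end HemiHerrmann

end DMax

theorem lemma4p3 (A : Set ℕ) :
    ((DMax.IsDMaximal A ∧ DMax.IsType4 A) ↔ DMax.IsHerrmann A) ∧
    ((DMax.IsDMaximal A ∧ DMax.IsType5 A) ↔ DMax.IsHemiHerrmann A) :=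
  ⟨DMax.isHerrmann_iff.symm,
    fun h => .of_isType5 h.1 h.2, fun h => ⟨h.isDMaximal, h.isType5⟩⟩
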